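/- Let $\mathcal O$ and $\mathcal M$ be the holomorphic and the meromorphic germs at $0\in\mathbb C$, let $\epsilon=t\,\frac{d}{dt}$, and consider linear differential operators with coefficients in $\mathcal M$, multiplied by composition. Each nonzero such operator has a unique standard form $a_0\epsilon^n+a_1\epsilon^{n-1}+\dots+a_n$ with $a_k\in\mathcal M$, $a_0\ne0$, where $n\ge 0$ is its order. It is Fuchsian if all $a_k\in\mathcal O$ and $a_0(0)\neq0$. Writing $a_k=\sum_{j\ge0}a_{k,j}t^j$ and $p_j(\epsilon)=\sum_{k=0}^n a_{k,j}\epsilon^{n-k}\in\mathbb C[\epsilon]$, a Fuchsian operator has the Taylor expansion $\sum_{j\ge0}t^jp_j(\epsilon)$; the polynomial $p_0$ is its Euler part. A Fuchsian operator $L$ is $\mathcal F$-equivalent to a Fuchsian operator $M$ of the same order if there are Fuchsian operators $H,K$ (of any orders) such that $MH=KL$ and the Euler parts of $H$ and $L$ are coprime in $\mathbb C[\epsilon]$. Let $L=\sum_{k=0}^n a_k(t)\epsilon^{n-k}=\sum_{j\ge0}t^jp_j(\epsilon)$ be a Fuchsian operator of order $n$, and let $N$ be the largest nonnegative integer that is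 a difference of two roots of $p_0$ (with $N=0$ if no two roots differ by a positive integer). Then $L$ is $\mathcal F$-equivalent to the polynomial operator $$M=\sum_{j=0}^N t^jp_j(\epsilon)=\sum_{k=0}^n b_k(t)\,\epsilon^{n-k}\in\mathbb C[t,\epsilon],$$ where $b_k\in\mathbb C[t]$, $\deg b_k\le N$, is the truncation of the Taylor series of $a_k$ at order $N$ (the terms of degree at most $N$). -/

import Mathlib

open Filter Topology Polynomial

noncomputable section

namespace Fuchs

/-! ### The differential field of meromorphic germs at the origin -/

/-- Germs at `0 ∈ ℂ` of meromorphic functions: functions on a punctured neighbourhood of the origin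
that are meromorphic at the origin, up to equality on a smaller punctured neighbourhood. -/
def meroSubring : Subring (Germ (𝓝[≠] (0 : ℂ)) ℂ) where
  carrier := {φ | ∃ f : ℂ → ℂ, MeromorphicAt f 0 ∧ φ = (f : Germ (𝓝[≠] (0 : ℂ)) ℂ)}
  mul_mem' := by
    rintro _ _ ⟨f, hf, rfl⟩ ⟨g, hg, rfl⟩
    exact ⟨f * g, hf.mul hg, rfl⟩
  one_mem' := ⟨1, MeromorphicAt.const 1 0, rfl⟩
  add_mem' := by
    rintro _ _ ⟨f, hf, rfl⟩ ⟨g, hg, rfl⟩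
    exact ⟨f + g, hf.add hg, rfl⟩
  zero_mem' := ⟨0, MeromorphicAt.const 0 0, rfl⟩
  neg_mem' := by
    rintro _ ⟨f, hf, rfl⟩
    exact ⟨-f, hf.neg, rfl⟩

/-- The ring of meromorphic germs at the origin. -/
abbrev MeroGerm : Type := meroSubring

/-- The germ of a function that is meromorphic at the origin. -/
def germ (f : ℂ → ℂ) (hf : MeromorphicAt f 0) : MeroGerm := ⟨(f : Germ (𝓝[≠] (0 : ℂ)) ℂ), f, hf, rfl⟩

theorem germ_eq_iff {f g : ℂ → ℂ} (hf : MeromorphicAt f 0) (hg : MeromorphicAt g 0) :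
    germ f hf = germ g hg ↔ f =ᶠ[𝓝[≠] 0] g := by
  rw [Subtype.ext_iff]
  exact Germ.coe_eq

theorem exists_germ (φ : MeroGerm) : ∃ f, ∃ hf : MeromorphicAt f 0, φ = germ f hf := by
  obtain ⟨_, f, hf, rfl⟩ := φ
  exact ⟨f, hf, rfl⟩

theorem germ_add {f g : ℂ → ℂ} (hf : MeromorphicAt f 0) (hg : MeromorphicAt g 0) :
    germ f hf + germ g hg = germ (f + g) (hf.add hg) := rfl

theorem germ_mul {f g : ℂ → ℂ} (hf : MeromorphicAt f 0) (hg : MeromorphicAt g 0) :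
    germ f hf * germ g hg = germ (f * g) (hf.mul hg) := rfl

/-- The constant germs. -/
def constGerm : ℂ →+* MeroGerm where
  toFun c := germ (fun _ => c) (MeromorphicAt.const c 0)
  map_one' := rfl
  map_mul' _ _ := rfl
  map_zero' := rfl
  map_add' _ _ := rfl

instance : Algebra ℂ MeroGerm := constGerm.toAlgebra

theorem smul_germ (c : ℂ) {f : ℂ → ℂ} (hf : MeromorphicAt f 0) :
    c • germ f hf = germ ((fun _ => c) * f) ((MeromorphicAt.const c 0).mul hf) := rfl

/-- The germ of the coordinate function `t`. -/
def tGerm : MeroGerm := germ (fun z => z) (MeromorphicAt.id 0)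

theorem deriv_eventuallyEq {f g : ℂ → ℂ} (h : f =ᶠ[𝓝[≠] (0 : ℂ)] g) :
    deriv f =ᶠ[𝓝[≠] (0 : ℂ)] deriv g := by
  have h2 : ∀ᶠ y in 𝓝 (0 : ℂ), y ≠ 0 → ∀ᶠ z in 𝓝 y, f z = g z := by
    have h1 := eventually_eventually_nhds.2 (eventually_nhdsWithin_iff.1 h)
    filter_upwards [h1] with y hy hy0
    filter_upwards [hy, isOpen_ne.mem_nhds hy0] with z hz hz0 using hz hz0
  refine eventually_nhdsWithin_iff.2 ?_
  filter_upwards [h2] with y hy hy0 using EventuallyEq.deriv_eq (hy hy0)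

/-- Differentiation of germs, as a function. -/
def derivFun (φ : MeroGerm) : MeroGerm :=
  germ (deriv (exists_germ φ).choose) (exists_germ φ).choose_spec.choose.deriv

theorem derivFun_germ {f : ℂ → ℂ} (hf : MeromorphicAt f 0) :
    derivFun (germ f hf) = germ (deriv f) hf.deriv := by
  refine (germ_eq_iff _ _).2 (deriv_eventuallyEq ?_)
  have h := (exists_germ (germ f hf)).choose_spec.choose_spec
  exact ((germ_eq_iff hf _).1 h).symm

theorem eventually_differentiableAt {f : ℂ → ℂ} (hf : MeromorphicAt f 0) :
    ∀ᶠ z in 𝓝[≠] (0 : ℂ), DifferentiableAt ℂ f z :=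
  hf.eventually_analyticAt.mono fun _ h => h.differentiableAt

/-- The derivation `∂ = d/dt` of the ring of meromorphic germs. -/
def ddt : Derivation ℂ MeroGerm MeroGerm :=
  Derivation.mk'
    { toFun := derivFun
      map_add' := by
        intro φ ψ
        obtain ⟨f, hf, rfl⟩ := exists_germ φ
        obtain ⟨g, hg, rfl⟩ := exists_germ ψ
        rw [germ_add, derivFun_germ, derivFun_germ, derivFun_germ, germ_add]
        refine (germ_eq_iff _ _).2 ?_
        filter_upwards [eventually_differentiableAt hf, eventually_differentiableAt hg]
          with z h1 h2 using deriv_add h1 h2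
      map_smul' := by
        intro c φ
        obtain ⟨f, hf, rfl⟩ := exists_germ φ
        rw [smul_germ, derivFun_germ, derivFun_germ, RingHom.id_apply, smul_germ]
        refine (germ_eq_iff _ _).2 ?_
        filter_upwards [eventually_differentiableAt hf] with z h1 using deriv_const_mul c h1 }
    (by
      intro φ ψ
      obtain ⟨f, hf, rfl⟩ := exists_germ φ
      obtain ⟨g, hg, rfl⟩ := exists_germ ψ
      change derivFun _ = _ * derivFun _ + _ * derivFun _
      rw [germ_mul, derivFun_germ, derivFun_germ, derivFun_germ, germ_mul, germ_mul, germ_add]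
      refine (germ_eq_iff _ _).2 ?_
      filter_upwards [eventually_differentiableAt hf, eventually_differentiableAt hg] with z h1 h2
      rw [deriv_mul h1 h2]
      simp only [Pi.add_apply, Pi.mul_apply]
      ring)

/-! ### Differential operators -/

/-- The operator of multiplication by a germ. -/
abbrev mulOp (a : MeroGerm) : Module.End ℂ MeroGerm := LinearMap.mulLeft ℂ a

/-- The Euler derivation `ϵ = t ∂`. -/
def eu : Module.End ℂ MeroGerm := mulOp tGerm * (ddt : MeroGerm →ₗ[ℂ] MeroGerm)

/-- The differential operator `∑ rᵢ ϵⁱ` (coefficients on the left, acting on meromorphic germs) with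
the standard form `∑ rᵢ Xⁱ`. Elements of the Weyl algebra are handled below through their standard
form `L : MeroGerm[X]`, with order `L.natDegree`. This is legitimate because the standard form of an
operator is unique (`toOp_injective`). The product of the Weyl algebra is the composition of the
operators `toOp L`, not the commutative product of polynomials, which is never used. -/
def toOp (L : MeroGerm[X]) : Module.End ℂ MeroGerm := ∑ i ∈ L.support, mulOp (L.coeff i) * eu ^ i

/-! ### Holomorphic germs and their Taylor coefficients -/

/-- The germ is holomorphic at the origin, i.e. it extends holomorphically to the origin. -/
def IsHol (φ : MeroGerm) : Prop := ∃ g : ℂ → ℂ, ∃ hg : AnalyticAt ℂ g 0, φ = germ g hg.meromorphicAt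

open Classical in
/-- The `j`-th Taylor coefficient at the origin of a holomorphic germ (and `0` otherwise). -/
def taylorCoeff (φ : MeroGerm) (j : ℕ) : ℂ :=
  if h : IsHol φ then iteratedDeriv j h.choose 0 / (j.factorial : ℂ) else 0

theorem taylorCoeff_germ {g : ℂ → ℂ} (hg : AnalyticAt ℂ g 0) (j : ℕ) :
    taylorCoeff (germ g hg.meromorphicAt) j = iteratedDeriv j g 0 / (j.factorial : ℂ) := by
  have h : IsHol (germ g hg.meromorphicAt) := ⟨g, hg, rfl⟩
  obtain ⟨h1, h2⟩ := h.choose_spec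
  have h3 : h.choose =ᶠ[𝓝[≠] 0] g := ((germ_eq_iff _ _).1 h2).symm
  have h4 : h.choose =ᶠ[𝓝 0] g :=
    (h1.frequently_eq_iff_eventually_eq hg).1 h3.frequently
  rw [taylorCoeff, dif_pos h, h4.iteratedDeriv_eq]

/-- The polynomial `pⱼ ∈ ℂ[ϵ]` of the noncommutative Taylor expansion `L = ∑ⱼ tʲ pⱼ(ϵ)` of an operator
`L = ∑ rᵢ ϵⁱ` with holomorphic coefficients: the coefficient of `ϵⁱ` in `pⱼ` is the `j`-th Taylor
coefficient of `rᵢ`. -/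
def taylorPoly (L : MeroGerm[X]) (j : ℕ) : ℂ[X] :=
  ∑ i ∈ L.support, monomial i (taylorCoeff (L.coeff i) j)

/-- The Euler part `p₀` of an operator. -/
def eulerPart (L : MeroGerm[X]) : ℂ[X] := taylorPoly L 0

/-! ### Fuchsian operators and Fuchsian equivalence -/

/-- The operator `r₀ ϵⁿ + ⋯ + rₙ` is Fuchsian: all coefficients are holomorphic at the origin and the
leading one does not vanish there. Nonvanishing holomorphic germs are Fuchsian operators of order `0`. -/
def IsFuchsian (L : MeroGerm[X]) : Prop :=
  (∀ i, IsHol (L.coeff i)) ∧ taylorCoeff L.leadingCoeff 0 ≠ 0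

/-- `L` is Fuchsian equivalent to `M`, for Fuchsian operators of the same order: `M H = K L` for some
Fuchsian operators `H`, `K` such that the Euler parts of `H` and `L` are coprime. -/
def FEquiv (L M : MeroGerm[X]) : Prop :=
  IsFuchsian L ∧ IsFuchsian M ∧ L.natDegree = M.natDegree ∧
    ∃ H K : MeroGerm[X], IsFuchsian H ∧ IsFuchsian K ∧ toOp M * toOp H = toOp K * toOp L ∧
      IsCoprime (eulerPart H) (eulerPart L)

/-- The largest natural number that is a difference of two roots of `p` (`0` if no difference of two
roots is a positive integer). For `p ≠ 0` the set is finite. -/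
def maxNatDiff (p : ℂ[X]) : ℕ :=
  sSup {j : ℕ | ∃ z w : ℂ, p.IsRoot z ∧ p.IsRoot w ∧ z - w = (j : ℂ)}

/-- The germ of a polynomial in `t`. -/
def polyGerm (b : ℂ[X]) : MeroGerm := aeval tGerm b

/-- The standard form of `∑_{j=0}^N tʲ pⱼ(ϵ)`, the truncation at order `N` of the Taylor expansion
`∑ tʲ pⱼ(ϵ)` of `L`. -/
def truncate (L : MeroGerm[X]) (N : ℕ) : MeroGerm[X] :=
  ∑ j ∈ Finset.range (N + 1), C (tGerm ^ j) * (taylorPoly L j).map (algebraMap ℂ MeroGerm)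

/-! ### Uniqueness of the standard form -/

theorem eu_tGerm_pow (m : ℕ) : eu (tGerm ^ m) = (m : ℂ) • tGerm ^ m := by
  have ht : ddt tGerm = 1 := by
    change derivFun _ = _
    rw [tGerm, derivFun_germ]
    refine (germ_eq_iff _ (MeromorphicAt.const 1 0)).2 (Eventually.of_forall fun z => ?_)
    simp
  have h : ddt (tGerm ^ m) = (m : MeroGerm) * tGerm ^ (m - 1) := by
    rw [Derivation.leibniz_pow, ht]; simp
  change tGerm * ddt (tGerm ^ m) = _
  rw [h, Algebra.smul_def, map_natCast]
  cases m with
  | zero => simp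
  | succ k => simp only [Nat.add_sub_cancel]; ring

theorem eu_pow_tGerm_pow (i m : ℕ) : (eu ^ i) (tGerm ^ m) = (m : ℂ) ^ i • tGerm ^ m := by
  induction i with
  | zero => simp
  | succ k ih => rw [pow_succ', Module.End.mul_apply, ih, map_smul, eu_tGerm_pow, smul_smul, pow_succ]

theorem tGerm_mul_eq_zero {φ : MeroGerm} (h : φ * tGerm = 0) : φ = 0 := by
  obtain ⟨f, hf, rfl⟩ := exists_germ φ
  have h1 : f * (fun z => z) =ᶠ[𝓝[≠] 0] fun _ => (0 : ℂ) :=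
    (germ_eq_iff (hf.mul (MeromorphicAt.id 0)) (MeromorphicAt.const 0 0)).1 h
  refine (germ_eq_iff hf (MeromorphicAt.const 0 0)).2 ?_
  filter_upwards [h1, self_mem_nhdsWithin] with z hz hz0
  exact (mul_eq_zero.1 hz).resolve_right hz0

theorem mul_eq_zero_iff {φ ψ : MeroGerm} (h : φ * ψ = 0) : φ = 0 ∨ ψ = 0 := by
  obtain ⟨f, hf, rfl⟩ := exists_germ φ
  obtain ⟨g, hg, rfl⟩ := exists_germ ψ
  have h1 : f * g =ᶠ[𝓝[≠] 0] fun _ => (0 : ℂ) :=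
    (germ_eq_iff (hf.mul hg) (MeromorphicAt.const 0 0)).1 h
  rcases hf.eventually_eq_zero_or_eventually_ne_zero with h2 | h2
  · exact Or.inl ((germ_eq_iff hf (MeromorphicAt.const 0 0)).2 h2)
  · refine Or.inr ((germ_eq_iff hg (MeromorphicAt.const 0 0)).2 ?_)
    filter_upwards [h1, h2] with z hz hz0
    exact (mul_eq_zero.1 hz).resolve_left hz0

instance : IsDomain MeroGerm :=
  have : NoZeroDivisors MeroGerm := ⟨mul_eq_zero_iff⟩
  NoZeroDivisors.to_isDomain MeroGerm

instance : CharZero MeroGerm := charZero_of_injective_algebraMap (algebraMap ℂ MeroGerm).injective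

theorem toOp_eq_sum_range (L : MeroGerm[X]) {n : ℕ} (hn : L.natDegree < n) :
    toOp L = ∑ i ∈ Finset.range n, mulOp (L.coeff i) * eu ^ i :=
  Finset.sum_subset (fun i hi => Finset.mem_range.2 ((le_natDegree_of_mem_supp i hi).trans_lt hn))
    (fun i _ hi => by rw [notMem_support_iff.1 hi]; ext; simp)

theorem toOp_tGerm_pow (L : MeroGerm[X]) (m : ℕ) :
    toOp L (tGerm ^ m) = L.eval (m : MeroGerm) * tGerm ^ m := by
  rw [toOp, LinearMap.sum_apply, eval_eq_sum, Polynomial.sum, Finset.sum_mul]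
  refine Finset.sum_congr rfl fun i _ => ?_
  rw [Module.End.mul_apply, eu_pow_tGerm_pow, LinearMap.mulLeft_apply, Algebra.smul_def, map_pow,
    map_natCast, mul_assoc]

theorem tGerm_ne_zero : tGerm ≠ 0 := fun h =>
  one_ne_zero (tGerm_mul_eq_zero (φ := 1) (by rw [h, mul_zero]))

/-- An operator has only one standard form. -/
theorem toOp_injective : Function.Injective toOp := by
  intro L M h
  refine eq_of_infinite_eval_eq L M ?_
  refine (Set.infinite_range_of_injective (Nat.cast_injective (R := MeroGerm))).mono ?_
  rintro _ ⟨m, rfl⟩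
  have h1 := congrArg (fun T : Module.End ℂ MeroGerm => T (tGerm ^ m)) h
  simp only [toOp_tGerm_pow] at h1
  exact mul_right_cancel₀ (pow_ne_zero m tGerm_ne_zero) h1

end Fuchs

end

noncomputable section

namespace Fuchs

/-! ### Taylor expansions of holomorphic germs -/

/-! Let n be the order of L. Dividing by the leading coefficient turns Lf = 0 and Mf = 0 into
companion systems ϵy = Ay and ϵy = By with holomorphic matrices, and A and B have the same N-jet. A
holomorphic solution Y of ϵY = BY - YA with Y(0) = 1 maps solutions of the first system to solutions
of the second, so its first row is an operator H of order < n with MH = KL for some K of order < n.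

Writing Y = 1 + W with W = O(t^(N+1)), the coefficient of t^j for j > N reads jW_j - (A_0 W_j - W_j
A_0) = terms in earlier W_i. The left side is invertible in W_j unless two eigenvalues of A_0 differ
by j. These eigenvalues are roots of p_0, so the choice of N excludes this. Since the inverses are
bounded uniformly in j, the formal solution converges (`exists_geomBdd_solution`, `exists_gauge`).
The passage from Y to H and K is `exists_mul_eq_mul_of_gauge`.

H and K need not be Fuchsian, as their leading coefficients may vanish at 0. But M(H + L) = (K +
M)L, and here both new factors inherit the leading coefficients of L and M. The Euler part of H is 1
because Y(0) = 1, so that of H + L is 1 + p_0, coprime to p_0. -/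

theorem isHol_germ {g : ℂ → ℂ} (hg : AnalyticAt ℂ g 0) : IsHol (germ g hg.meromorphicAt) :=
  ⟨g, hg, rfl⟩

theorem IsHol.add {φ ψ : MeroGerm} (hφ : IsHol φ) (hψ : IsHol ψ) : IsHol (φ + ψ) := by
  obtain ⟨f, hf, rfl⟩ := hφ
  obtain ⟨g, hg, rfl⟩ := hψ
  exact ⟨f + g, hf.add hg, rfl⟩

theorem IsHol.mul {φ ψ : MeroGerm} (hφ : IsHol φ) (hψ : IsHol ψ) : IsHol (φ * ψ) := by
  obtain ⟨f, hf, rfl⟩ := hφ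
  obtain ⟨g, hg, rfl⟩ := hψ
  exact ⟨f * g, hf.mul hg, rfl⟩

theorem isHol_algebraMap (c : ℂ) : IsHol (algebraMap ℂ MeroGerm c) :=
  ⟨fun _ => c, analyticAt_const, rfl⟩

theorem isHol_zero : IsHol 0 := by simpa using isHol_algebraMap 0

theorem isHol_one : IsHol 1 := by simpa using isHol_algebraMap 1

theorem IsHol.neg {φ : MeroGerm} (hφ : IsHol φ) : IsHol (-φ) := by
  obtain ⟨f, hf, rfl⟩ := hφ
  exact ⟨-f, hf.neg, rfl⟩

theorem IsHol.sub {φ ψ : MeroGerm} (hφ : IsHol φ) (hψ : IsHol ψ) : IsHol (φ - ψ) := by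
  rw [sub_eq_add_neg]
  exact hφ.add hψ.neg

theorem isHol_sum {ι : Type*} (s : Finset ι) {φ : ι → MeroGerm} (h : ∀ i ∈ s, IsHol (φ i)) :
    IsHol (∑ i ∈ s, φ i) :=
  Finset.sum_induction _ IsHol (fun _ _ => IsHol.add) isHol_zero h

theorem isHol_tGerm : IsHol tGerm := ⟨fun z => z, analyticAt_id, rfl⟩

theorem IsHol.ddt {φ : MeroGerm} (hφ : IsHol φ) : IsHol (ddt φ) := by
  obtain ⟨f, hf, rfl⟩ := hφ
  exact ⟨deriv f, hf.deriv, derivFun_germ _⟩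

theorem eu_apply (φ : MeroGerm) : eu φ = tGerm * ddt φ := rfl

theorem IsHol.eu {φ : MeroGerm} (hφ : IsHol φ) : IsHol (eu φ) := isHol_tGerm.mul hφ.ddt

theorem taylorCoeff_add {φ ψ : MeroGerm} (hφ : IsHol φ) (hψ : IsHol ψ) (j : ℕ) :
    taylorCoeff (φ + ψ) j = taylorCoeff φ j + taylorCoeff ψ j := by
  obtain ⟨f, hf, rfl⟩ := hφ
  obtain ⟨g, hg, rfl⟩ := hψ
  rw [germ_add, taylorCoeff_germ (hf.add hg), taylorCoeff_germ hf, taylorCoeff_germ hg,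
    iteratedDeriv_add hf.contDiffAt hg.contDiffAt, add_div]

theorem taylorCoeff_algebraMap (c : ℂ) (j : ℕ) :
    taylorCoeff (algebraMap ℂ MeroGerm c) j = if j = 0 then c else 0 := by
  have : algebraMap ℂ MeroGerm c = germ (fun _ => c) (analyticAt_const (𝕜 := ℂ)).meromorphicAt :=
    rfl
  rw [this, taylorCoeff_germ analyticAt_const, iteratedDeriv_const]
  split_ifs with h <;> simp [h]

theorem taylorCoeff_zero (j : ℕ) : taylorCoeff 0 j = 0 := by
  simpa using taylorCoeff_algebraMap 0 j

theorem taylorCoeff_one (j : ℕ) : taylorCoeff 1 j = if j = 0 then 1 else 0 := by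
  simpa using taylorCoeff_algebraMap 1 j

theorem taylorCoeff_neg {φ : MeroGerm} (hφ : IsHol φ) (j : ℕ) :
    taylorCoeff (-φ) j = -taylorCoeff φ j := by
  have h := taylorCoeff_add hφ hφ.neg j
  rw [add_neg_cancel, taylorCoeff_zero] at h
  exact (neg_eq_of_add_eq_zero_right h.symm).symm

theorem taylorCoeff_sub {φ ψ : MeroGerm} (hφ : IsHol φ) (hψ : IsHol ψ) (j : ℕ) :
    taylorCoeff (φ - ψ) j = taylorCoeff φ j - taylorCoeff ψ j := by
  rw [sub_eq_add_neg, taylorCoeff_add hφ hψ.neg, taylorCoeff_neg hψ, sub_eq_add_neg]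

theorem taylorCoeff_sum {ι : Type*} (s : Finset ι) {φ : ι → MeroGerm} (h : ∀ i ∈ s, IsHol (φ i))
    (j : ℕ) : taylorCoeff (∑ i ∈ s, φ i) j = ∑ i ∈ s, taylorCoeff (φ i) j := by
  classical
  induction s using Finset.induction_on with
  | empty => simp [taylorCoeff_zero]
  | insert a s ha ih =>
    have hs : ∀ i ∈ s, IsHol (φ i) := fun i hi => h i (Finset.mem_insert_of_mem hi)
    rw [Finset.sum_insert ha, Finset.sum_insert ha,
      taylorCoeff_add (h a (Finset.mem_insert_self a s)) (isHol_sum s hs), ih hs]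

theorem taylorCoeff_mul {φ ψ : MeroGerm} (hφ : IsHol φ) (hψ : IsHol ψ) (j : ℕ) :
    taylorCoeff (φ * ψ) j =
      ∑ i ∈ Finset.range (j + 1), taylorCoeff φ i * taylorCoeff ψ (j - i) := by
  obtain ⟨f, hf, rfl⟩ := hφ
  obtain ⟨g, hg, rfl⟩ := hψ
  rw [germ_mul, taylorCoeff_germ (hf.mul hg), iteratedDeriv_mul hf.contDiffAt hg.contDiffAt,
    Finset.sum_div]
  refine Finset.sum_congr rfl fun i hi => ?_
  rw [taylorCoeff_germ hf, taylorCoeff_germ hg,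
    Nat.cast_choose ℂ (Nat.lt_succ_iff.1 (Finset.mem_range.1 hi))]
  have h1 : ((j.factorial : ℕ) : ℂ) ≠ 0 := Nat.cast_ne_zero.2 j.factorial_ne_zero
  field_simp

theorem taylorCoeff_mul_zero {φ ψ : MeroGerm} (hφ : IsHol φ) (hψ : IsHol ψ) :
    taylorCoeff (φ * ψ) 0 = taylorCoeff φ 0 * taylorCoeff ψ 0 := by
  simp [taylorCoeff_mul hφ hψ]

theorem taylorCoeff_tGerm (j : ℕ) : taylorCoeff tGerm j = if j = 1 then 1 else 0 := by
  have : tGerm = germ (fun z => z) (analyticAt_id (𝕜 := ℂ)).meromorphicAt := rfl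
  have ha : AnalyticAt ℂ (fun z : ℂ => z) 0 := analyticAt_id
  rw [this, taylorCoeff_germ ha]
  rcases j with _ | _ | j
  · simp
  · simp
  · have h : deriv (fun z : ℂ => z) = fun _ => 1 := by ext; simp
    rw [iteratedDeriv_succ', h, iteratedDeriv_const]
    simp

theorem taylorCoeff_tGerm_mul_zero {φ : MeroGerm} (hφ : IsHol φ) :
    taylorCoeff (tGerm * φ) 0 = 0 := by
  simp [taylorCoeff_mul_zero isHol_tGerm hφ, taylorCoeff_tGerm]

theorem taylorCoeff_tGerm_mul_succ {φ : MeroGerm} (hφ : IsHol φ) (j : ℕ) :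
    taylorCoeff (tGerm * φ) (j + 1) = taylorCoeff φ j := by
  simp [taylorCoeff_mul isHol_tGerm hφ, taylorCoeff_tGerm]

theorem taylorCoeff_ddt {φ : MeroGerm} (hφ : IsHol φ) (j : ℕ) :
    taylorCoeff (ddt φ) j = (j + 1) * taylorCoeff φ (j + 1) := by
  obtain ⟨f, hf, rfl⟩ := hφ
  have : ddt (germ f hf.meromorphicAt) = germ (deriv f) hf.deriv.meromorphicAt := derivFun_germ _
  rw [this, taylorCoeff_germ hf.deriv, taylorCoeff_germ hf, ← iteratedDeriv_succ', Nat.factorial_succ]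
  have h1 : ((j.factorial : ℕ) : ℂ) ≠ 0 := Nat.cast_ne_zero.2 j.factorial_ne_zero
  have h2 : (j : ℂ) + 1 ≠ 0 := Nat.cast_add_one_ne_zero j
  push_cast
  field_simp

theorem taylorCoeff_eu {φ : MeroGerm} (hφ : IsHol φ) (j : ℕ) :
    taylorCoeff (eu φ) j = j * taylorCoeff φ j := by
  rw [eu_apply]
  cases j with
  | zero => simp [taylorCoeff_tGerm_mul_zero hφ.ddt]
  | succ j => rw [taylorCoeff_tGerm_mul_succ hφ.ddt, taylorCoeff_ddt hφ]; push_cast; ring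

theorem IsHol.ext {φ ψ : MeroGerm} (hφ : IsHol φ) (hψ : IsHol ψ)
    (h : ∀ j, taylorCoeff φ j = taylorCoeff ψ j) : φ = ψ := by
  obtain ⟨f, hf, rfl⟩ := hφ
  obtain ⟨g, hg, rfl⟩ := hψ
  simp only [taylorCoeff_germ hf, taylorCoeff_germ hg] at h
  have hg' := hg.hasFPowerSeriesAt
  rw [← funext h] at hg'
  refine (germ_eq_iff _ _).2 (Eventually.filter_mono nhdsWithin_le_nhds ?_)
  filter_upwards [hf.hasFPowerSeriesAt.eventually_hasSum_sub, hg'.eventually_hasSum_sub]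
    with z h1 h2 using h1.unique h2

theorem IsHol.exists_mul_eq_one {φ : MeroGerm} (hφ : IsHol φ) (h : taylorCoeff φ 0 ≠ 0) :
    ∃ ψ, IsHol ψ ∧ φ * ψ = 1 := by
  obtain ⟨f, hf, rfl⟩ := hφ
  have h0 : f 0 ≠ 0 := by simpa [taylorCoeff_germ hf] using h
  refine ⟨_, isHol_germ (hf.inv h0), ?_⟩
  rw [germ_mul]
  refine (germ_eq_iff _ (MeromorphicAt.const 1 0)).2 (Eventually.filter_mono nhdsWithin_le_nhds ?_)
  filter_upwards [hf.continuousAt.eventually_ne h0] with z hz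
  exact mul_inv_cancel₀ hz

/-- A sequence that grows at most geometrically. -/
def GeomBdd {E : Type*} [Norm E] (c : ℕ → E) : Prop :=
  ∃ C ρ : ℝ, 0 < C ∧ 0 < ρ ∧ ∀ j, ‖c j‖ ≤ C * ρ ^ j

/-- This and `GeomBdd.exists_isHol` identify holomorphic germs with geometrically bounded
coefficient sequences. Convergence questions thereby become norm estimates. -/
theorem IsHol.geomBdd {φ : MeroGerm} (hφ : IsHol φ) : GeomBdd (taylorCoeff φ) := by
  obtain ⟨f, hf, rfl⟩ := hφ
  obtain ⟨r, hr0, hr⟩ := ENNReal.lt_iff_exists_nnreal_btwn.1 hf.hasFPowerSeriesAt.radius_pos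
  have hr0' : 0 < r := by exact_mod_cast hr0
  obtain ⟨C, hC, h⟩ := FormalMultilinearSeries.norm_mul_pow_le_of_lt_radius _ hr
  refine ⟨C, (r : ℝ)⁻¹, hC, by positivity, fun j => ?_⟩
  rw [taylorCoeff_germ hf, inv_pow, ← div_eq_mul_inv, le_div_iff₀ (by positivity)]
  simpa only [FormalMultilinearSeries.ofScalars_norm] using h j

theorem GeomBdd.exists_isHol {c : ℕ → ℂ} (hc : GeomBdd c) :
    ∃ φ, IsHol φ ∧ ∀ j, taylorCoeff φ j = c j := by
  obtain ⟨C, ρ, hC, hρ, h⟩ := hc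
  let p := FormalMultilinearSeries.ofScalars ℂ c
  have hr : 0 < p.radius := by
    refine lt_of_lt_of_le ?_ (p.le_radius_of_bound C (r := ⟨ρ⁻¹, by positivity⟩) fun j => ?_)
    · exact ENNReal.coe_pos.2 (NNReal.coe_pos.1 (inv_pos.2 hρ))
    · rw [FormalMultilinearSeries.ofScalars_norm]
      change ‖c j‖ * ρ⁻¹ ^ j ≤ C
      rw [inv_pow, ← div_eq_mul_inv, div_le_iff₀ (by positivity)]
      exact h j
  have hp : HasFPowerSeriesAt p.sum p 0 := (p.hasFPowerSeriesOnBall hr).hasFPowerSeriesAt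
  refine ⟨_, isHol_germ hp.analyticAt, fun j => ?_⟩
  rw [taylorCoeff_germ hp.analyticAt]
  have h1 := hp.analyticAt.hasFPowerSeriesAt.eq_formalMultilinearSeries hp
  exact congrFun (FormalMultilinearSeries.ofScalars_series_injective ℂ (E := ℂ) h1) j

/-! ### Geometrically bounded sequences -/

section
variable {E F : Type*} [NormedAddCommGroup E] [NormedAddCommGroup F]

theorem GeomBdd.add {c d : ℕ → E} (hc : GeomBdd c) (hd : GeomBdd d) :
    GeomBdd fun j => c j + d j := by
  obtain ⟨C, ρ, hC, hρ, h⟩ := hc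
  obtain ⟨D, σ, hD, hσ, k⟩ := hd
  refine ⟨C + D, max ρ σ, by positivity, by positivity, fun j => (norm_add_le _ _).trans ?_⟩
  rw [add_mul]
  refine add_le_add ((h j).trans ?_) ((k j).trans ?_)
  · gcongr; exact le_max_left _ _
  · gcongr; exact le_max_right _ _

theorem GeomBdd.zero : GeomBdd fun _ : ℕ => (0 : E) :=
  ⟨1, 1, one_pos, one_pos, fun j => by simp⟩

theorem GeomBdd.sum {ι : Type*} (s : Finset ι) {c : ι → ℕ → E} (h : ∀ i ∈ s, GeomBdd (c i)) :
    GeomBdd fun j => ∑ i ∈ s, c i j := by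
  have := Finset.sum_induction c GeomBdd (fun _ _ => GeomBdd.add) GeomBdd.zero h
  convert this using 1
  ext j
  simp

theorem GeomBdd.map [NormedSpace ℂ E] [NormedSpace ℂ F] [FiniteDimensional ℂ E] {c : ℕ → E}
    (hc : GeomBdd c) (f : E →ₗ[ℂ] F) :
    GeomBdd fun j => f (c j) := by
  obtain ⟨C, ρ, hC, hρ, h⟩ := hc
  -- The `+ 1` keeps the constant positive when `f = 0`.
  refine ⟨(‖LinearMap.toContinuousLinearMap f‖ + 1) * C, ρ, by positivity, hρ, fun j => ?_⟩
  refine ((LinearMap.toContinuousLinearMap f).le_opNorm (c j)).trans ?_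
  rw [mul_assoc]
  exact mul_le_mul (by linarith) (h j) (norm_nonneg _) (by positivity)

end

/-! ### Convergence of formal solutions of Fuchsian systems -/

section
variable {E : Type*}

/-- The sequence determined by the recursion `z j = F j z`, where `F j z` only depends on the terms
of `z` before `j`. -/
def strongRec (F : (j : ℕ) → (Fin j → E) → E) (j : ℕ) : E :=
  F j fun i => strongRec F i
termination_by j
decreasing_by exact i.2

theorem strongRec_eq (F : (j : ℕ) → (Fin j → E) → E) (j : ℕ) :
    strongRec F j = F j fun i => strongRec F i := by
  rw [strongRec]

variable [NormedAddCommGroup E]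

/-- A sequence dominated by a convolution of itself with a geometric sequence is geometrically
bounded. -/
theorem geomBdd_of_norm_le_convolution {z : ℕ → E} {K ρ : ℝ} (hK : 0 < K) (hρ : 0 < ρ)
    (h : ∀ j, ‖z j‖ ≤ ∑ i ∈ Finset.range j, K * ρ ^ (j - i) * ‖z i‖ + K * ρ ^ j) :
    GeomBdd z := by
  -- With the ratio `ρ * (1 + 2 * K)` the geometric sum produces a term `-K * ρ ^ j` that cancels
  -- the inhomogeneous one. What remains is half of the claimed bound.
  refine ⟨2 * K, ρ * (1 + 2 * K), by positivity, by positivity, fun j => ?_⟩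
  induction j using Nat.strong_induction_on with
  | _ j ih =>
  have hs : ∑ i ∈ Finset.range j, (1 + 2 * K) ^ i = ((1 + 2 * K) ^ j - 1) / (2 * K) := by
    rw [geom_sum_eq (by linarith)]
    ring
  calc ‖z j‖ ≤ ∑ i ∈ Finset.range j, K * ρ ^ (j - i) * ‖z i‖ + K * ρ ^ j := h j
    _ ≤ ∑ i ∈ Finset.range j, K * ρ ^ (j - i) * (2 * K * (ρ * (1 + 2 * K)) ^ i) + K * ρ ^ j := by
        gcongr with i hi
        exact ih i (Finset.mem_range.1 hi)
    _ = ∑ i ∈ Finset.range j, 2 * K * K * ρ ^ j * (1 + 2 * K) ^ i + K * ρ ^ j := by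
        congr 1
        refine Finset.sum_congr rfl fun i hi => ?_
        rw [← Nat.sub_add_cancel (Finset.mem_range.1 hi).le, pow_add ρ (j - i) i,
          Nat.sub_add_cancel (Finset.mem_range.1 hi).le, mul_pow]
        ring
    _ = K * (ρ * (1 + 2 * K)) ^ j := by
        rw [← Finset.mul_sum, hs, mul_pow]
        field_simp
        ring
    _ ≤ 2 * K * (ρ * (1 + 2 * K)) ^ j := by
        gcongr
        linarith

variable [NormedSpace ℂ E] [FiniteDimensional ℂ E]

/-- For `j` beyond the norm of `T`, the scalar part dominates and the bound holds with constant 1.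
The finitely many other `j > N` are handled one at a time: an injective linear map on a
finite-dimensional space is bounded below. -/
theorem exists_norm_le_mul_norm_smul_sub (T : E →ₗ[ℂ] E) (N : ℕ)
    (hT : ∀ j : ℕ, N < j → ∀ z, T z = (j : ℂ) • z → z = 0) :
    ∃ c : ℝ, 0 < c ∧ ∀ j : ℕ, N < j → ∀ z, ‖z‖ ≤ c * ‖(j : ℂ) • z - T z‖ := by
  let T' := LinearMap.toContinuousLinearMap T
  have hfin : ∀ j : ℕ, ∃ c : ℝ, 0 < c ∧ (N < j → ∀ z, ‖z‖ ≤ c * ‖(j : ℂ) • z - T z‖) := by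
    intro j
    by_cases hj : N < j
    · have hker : LinearMap.ker ((j : ℂ) • (LinearMap.id : E →ₗ[ℂ] E) - T) = ⊥ := by
        rw [LinearMap.ker_eq_bot']
        intro z hz
        refine hT j hj z (sub_eq_zero.1 ?_).symm
        simpa using hz
      obtain ⟨K, hK, h⟩ := LinearMap.exists_antilipschitzWith _ hker
      refine ⟨K, hK, fun _ z => ?_⟩
      simpa using ZeroHomClass.bound_of_antilipschitz _ h z
    · exact ⟨1, one_pos, fun h => absurd h hj⟩
  choose c hc hcz using hfin
  obtain ⟨J, hJ⟩ := exists_nat_gt (‖T'‖ + 1)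
  -- The summand 1 serves all `j ≥ J`; the sum exceeds each individual constant for `j < J`.
  refine ⟨1 + ∑ j ∈ Finset.range J, c j, ?_, fun j hj z => ?_⟩
  · have := Finset.sum_nonneg fun j (_ : j ∈ Finset.range J) => (hc j).le
    linarith
  · by_cases hjJ : j < J
    · refine (hcz j hj z).trans ?_
      gcongr
      have := Finset.single_le_sum (fun j _ => (hc j).le) (Finset.mem_range.2 hjJ)
      linarith
    · have h1 : ‖T z‖ ≤ ‖T'‖ * ‖z‖ := T'.le_opNorm z
      have h2 : ‖(j : ℂ) • z‖ = j * ‖z‖ := by rw [norm_smul, Complex.norm_natCast]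
      have h3 := norm_sub_norm_le ((j : ℂ) • z) (T z)
      have h4 : (J : ℝ) ≤ j := by exact_mod_cast not_lt.1 hjJ
      have h5 : ‖z‖ ≤ ‖(j : ℂ) • z - T z‖ := by
        nlinarith [norm_nonneg z]
      have := Finset.sum_nonneg fun j (_ : j ∈ Finset.range J) => (hc j).le
      nlinarith [norm_nonneg ((j : ℂ) • z - T z)]

/-- If no integer `j > N` is an eigenvalue of `T 0`, the inhomogeneous Fuchsian system
`ϵ z = (∑ tⁱ T i) z + g` with `g = O(t ^ (N + 1))` has a convergent solution `z = O(t ^ (N + 1))`. -/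
theorem exists_geomBdd_solution (T : ℕ → E →ₗ[ℂ] E) (g : ℕ → E) (N : ℕ) {C ρ : ℝ} (hC : 0 < C)
    (hρ : 0 < ρ) (hTb : ∀ i z, ‖T i z‖ ≤ C * ρ ^ i * ‖z‖) (hg : GeomBdd g)
    (hgN : ∀ j ≤ N, g j = 0) (hT : ∀ j : ℕ, N < j → ∀ z, T 0 z = (j : ℂ) • z → z = 0) :
    ∃ z : ℕ → E, GeomBdd z ∧ (∀ j ≤ N, z j = 0) ∧
      ∀ j : ℕ, (j : ℂ) • z j = ∑ i ∈ Finset.range (j + 1), T (j - i) (z i) + g j := by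
  obtain ⟨c, hc, hcz⟩ := exists_norm_le_mul_norm_smul_sub (T 0) N hT
  obtain ⟨D, σ, hD, hσ, hgb⟩ := hg
  -- The implication sits inside the existential so that `choose` yields a total solution operator
  -- `S`, arbitrary for `j ≤ N`.
  have hsurj : ∀ (j : ℕ) (y : E), ∃ z : E, N < j → (j : ℂ) • z - T 0 z = y := by
    intro j y
    by_cases hj : N < j
    · have hinj : Function.Injective ((j : ℂ) • (LinearMap.id : E →ₗ[ℂ] E) - T 0) := by
        rw [← LinearMap.ker_eq_bot, LinearMap.ker_eq_bot']
        intro z hz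
        refine hT j hj z (sub_eq_zero.1 ?_).symm
        simpa using hz
      obtain ⟨z, hz⟩ := LinearMap.injective_iff_surjective.1 hinj y
      exact ⟨z, fun _ => by simpa using hz⟩
    · exact ⟨0, fun h => absurd h hj⟩
  choose S hS using hsurj
  let z : ℕ → E := strongRec fun j w =>
    if j ≤ N then 0 else S j (∑ i : Fin j, T (j - i) (w i) + g j)
  have hz0 : ∀ j ≤ N, z j = 0 := fun j hj => by
    change strongRec _ j = 0
    rw [strongRec_eq, if_pos hj]
  have hz1 : ∀ j, N < j → (j : ℂ) • z j - T 0 (z j) =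
      ∑ i ∈ Finset.range j, T (j - i) (z i) + g j := fun j hj => by
    have : z j = S j (∑ i : Fin j, T (j - i) (z i) + g j) := by
      change strongRec _ j = _
      rw [strongRec_eq, if_neg (not_le.2 hj)]
    rw [← Fin.sum_univ_eq_sum_range fun i => T (j - i) (z i)]
    conv_lhs => rw [this]
    exact hS j _ hj
  refine ⟨z, ?_, hz0, fun j => ?_⟩
  · have hK : (0 : ℝ) < c * (C + D) := by positivity
    have hτ : (0 : ℝ) < max ρ σ := lt_max_of_lt_left hρ
    refine geomBdd_of_norm_le_convolution hK hτ fun j => ?_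
    by_cases hj : N < j
    · refine (hcz j hj (z j)).trans ?_
      rw [hz1 j hj]
      have h1 : ‖∑ i ∈ Finset.range j, T (j - i) (z i)‖ ≤
          ∑ i ∈ Finset.range j, (C + D) * max ρ σ ^ (j - i) * ‖z i‖ := by
        refine norm_sum_le_of_le _ fun i _ => (hTb _ _).trans ?_
        gcongr
        · linarith
        · exact le_max_left _ _
      have h2 : ‖g j‖ ≤ (C + D) * max ρ σ ^ j := by
        refine (hgb j).trans ?_
        gcongr
        · linarith
        · exact le_max_right _ _
      calc c * ‖∑ i ∈ Finset.range j, T (j - i) (z i) + g j‖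
          ≤ c * (∑ i ∈ Finset.range j, (C + D) * max ρ σ ^ (j - i) * ‖z i‖ +
              (C + D) * max ρ σ ^ j) := by
            gcongr
            exact (norm_add_le _ _).trans (add_le_add h1 h2)
        _ = _ := by
            rw [mul_add, Finset.mul_sum]
            simp only [mul_assoc]
    · rw [hz0 j (not_lt.1 hj), norm_zero]
      positivity
  -- For `j ≤ N` every term of the recursion vanishes, so resonances up to `N` cause no obstruction.
  · by_cases hj : N < j
    · rw [Finset.sum_range_succ, Nat.sub_self, add_right_comm, ← hz1 j hj, sub_add_cancel]
    · rw [hz0 j (not_lt.1 hj), hgN j (not_lt.1 hj), smul_zero, add_zero, Finset.sum_eq_zero]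
      intro i hi
      rw [hz0 i (by have := Finset.mem_range.1 hi; omega), map_zero]

end

/-! ### Companion matrices -/

/-- The companion matrix of `X ^ (m + 1) + c m X ^ m + ⋯ + c 0`: row `s` lists the coordinates of
`X * X ^ s` modulo this polynomial. -/
def companion {R : Type*} [Ring R] (m : ℕ) (c : ℕ → R) : Matrix (Fin (m + 1)) (Fin (m + 1)) R :=
  Matrix.of fun s i => (if (s : ℕ) + 1 = i then 1 else 0) - if s = Fin.last m then c i else 0

theorem companion_apply {R : Type*} [Ring R] (m : ℕ) (c : ℕ → R) (s i : Fin (m + 1)) :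
    companion m c s i =
      (if (s : ℕ) + 1 = i then 1 else 0) - if s = Fin.last m then c i else 0 := rfl

theorem companion_last {R : Type*} [Ring R] (m : ℕ) (c : ℕ → R) (i : Fin (m + 1)) :
    companion m c (Fin.last m) i = -c i := by
  have : ¬ (m + 1 = (i : ℕ)) := by omega
  simp [companion_apply, this]

theorem companion_of_lt {R : Type*} [Ring R] {m : ℕ} (c : ℕ → R) {s : ℕ} (hs : s < m)
    (i : Fin (m + 1)) :
    companion m c ⟨s, by omega⟩ i = if (⟨s + 1, by omega⟩ : Fin (m + 1)) = i then 1 else 0 := by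
  have : (⟨s, by omega⟩ : Fin (m + 1)) ≠ Fin.last m := by
    intro h
    have := congrArg Fin.val h
    simp at this
    omega
  simp [companion_apply, this, Fin.ext_iff]

/-- The first basis row vector is cyclic: its successive images run through the whole basis. -/
theorem companion_pow_apply_zero {R : Type*} [CommRing R] {m : ℕ} (c : ℕ → R) {i : ℕ} (hi : i < m + 1)
    (k : Fin (m + 1)) : (companion m c ^ i) 0 k = if (⟨i, hi⟩ : Fin (m + 1)) = k then 1 else 0 := by
  induction i generalizing k with
  | zero => simp [Matrix.one_apply, Fin.ext_iff]
  | succ i ih =>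
    rw [pow_succ, Matrix.mul_apply]
    simp only [ih (by omega), ite_mul, one_mul, zero_mul, Finset.sum_ite_eq, Finset.mem_univ,
      if_true]
    exact companion_of_lt c (by omega) k

theorem companion_pow_last_apply_zero {R : Type*} [CommRing R] {m : ℕ} (c : ℕ → R)
    (k : Fin (m + 1)) : (companion m c ^ (m + 1)) 0 k = -c k := by
  rw [pow_succ, Matrix.mul_apply]
  simp only [companion_pow_apply_zero c (Nat.lt_succ_self m), ite_mul, one_mul, zero_mul,
    Finset.sum_ite_eq, Finset.mem_univ, if_true]
  exact companion_last m c k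

/-- Row 0 of `p(A)` vanishes by the choice of `c`. By cyclicity row `i` is row 0 of `A ^ i * p(A) =
p(A) * A ^ i`, hence also zero. The form of `hc` allows `p` not to be monic. -/
theorem aeval_companion {R : Type*} [CommRing R] {m : ℕ} {c : ℕ → R} {p : R[X]}
    (hp : p.natDegree ≤ m + 1) (hc : ∀ i, p.coeff (m + 1) * c i = p.coeff i) :
    aeval (companion m c) p = 0 := by
  set A := companion m c with hA
  have h0 : ∀ k, (aeval A p) 0 k = 0 := by
    intro k
    rw [aeval_eq_sum_range' (Nat.lt_succ_of_le hp), Matrix.sum_apply, Finset.sum_range_succ]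
    simp only [Matrix.smul_apply, smul_eq_mul]
    rw [hA, companion_pow_last_apply_zero, mul_neg, hc,
      ← Fin.sum_univ_eq_sum_range (fun i => p.coeff i * (companion m c ^ i) 0 k)]
    have : ∀ i : Fin (m + 1), p.coeff i * (companion m c ^ (i : ℕ)) 0 k =
        if i = k then p.coeff i else 0 := by
      intro i
      rw [companion_pow_apply_zero c i.2]
      simp
    simp [this]
  ext i k
  have h1 : (A ^ (i : ℕ) * aeval A p) 0 k = (aeval A p) i k := by
    rw [Matrix.mul_apply]
    simp [hA, companion_pow_apply_zero c i.2]
  have h2 : A ^ (i : ℕ) * aeval A p = aeval A p * A ^ (i : ℕ) := by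
    have h3 : A ^ (i : ℕ) = aeval A (X ^ (i : ℕ) : R[X]) := by simp
    rw [h3, ← map_mul, ← map_mul, mul_comm]
  rw [← h1, h2, Matrix.mul_apply]
  simp [h0]

/-- The relation says `A * Z = Z * (A + a)`, so `Z * q(A + a) = q(A) * Z` for every polynomial `q`.
For `q = p` the right side is 0, while the Bézout identity evaluated at `A` makes `p(A + a)`
invertible. -/
theorem eq_zero_of_commutator_eq_smul {R : Type*} [Ring R] [Algebra ℂ R] {A Z : R} {p : ℂ[X]} {a : ℂ}
    (hp : aeval A p = 0) (hcop : IsCoprime p (p.comp (X + C a))) (h : A * Z - Z * A = a • Z) :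
    Z = 0 := by
  have h1 : SemiconjBy Z (aeval A (X + C a)) A := by
    have : A * Z = Z * A + a • Z := by rw [← h]; abel
    simp [SemiconjBy, mul_add, this, ← Algebra.commutes, Algebra.smul_def]
  have h2 : ∀ q : ℂ[X], Z * aeval A (q.comp (X + C a)) = aeval A q * Z := by
    intro q
    rw [aeval_comp]
    induction q using Polynomial.induction_on' with
    | add q r hq hr => rw [map_add (aeval _) q r, map_add (aeval A) q r, mul_add, add_mul, hq, hr]
    | monomial n c =>
      rw [aeval_monomial, aeval_monomial, ← mul_assoc, ← Algebra.commutes, mul_assoc, mul_assoc,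
        (h1.pow_right n).eq]
  obtain ⟨u, v, huv⟩ := hcop
  have h3 : aeval A (p.comp (X + C a)) * aeval A v = 1 := by
    rw [← map_mul, mul_comm _ v, ← map_one (aeval (R := ℂ) A), ← huv, map_add, map_mul _ u, hp, mul_zero,
      zero_add, map_mul]
  rw [← mul_one Z, ← h3, ← mul_assoc, h2, hp, zero_mul, zero_mul]

/-- A common root `w` would make `w` and `w + j` roots of `p` with difference `j`, contradicting
maximality. -/
theorem isCoprime_comp_of_maxNatDiff_lt {p : ℂ[X]} (hp : p ≠ 0) {j : ℕ} (hj : maxNatDiff p < j) :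
    IsCoprime p (p.comp (X + C (j : ℂ))) := by
  rw [isCoprime_iff_aeval_ne_zero_of_isAlgClosed ℂ ℂ]
  intro w
  by_contra! hw
  simp only [coe_aeval_eq_eval, eval_comp, eval_add, eval_X, eval_C] at hw
  -- The supremum of an unbounded set of naturals is 0 by convention, so finiteness is needed before
  -- it can serve as an upper bound.
  have hfin : {j : ℕ | ∃ z w : ℂ, p.IsRoot z ∧ p.IsRoot w ∧ z - w = (j : ℂ)}.Finite := by
    have hr : {z | p.IsRoot z}.Finite := finite_setOfPred_isRoot hp
    refine ((hr.prod hr).image fun x : ℂ × ℂ => x.1 - x.2).preimage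
      (Nat.cast_injective (R := ℂ)).injOn |>.subset ?_
    rintro i ⟨z, w, hz, hw, h⟩
    exact ⟨(z, w), ⟨hz, hw⟩, h⟩
  exact not_le.2 hj (le_csSup hfin.bddAbove ⟨w + j, w, hw.2, hw.1, by ring⟩)

/-! ### Holomorphic gauge equivalence of Fuchsian systems -/

section
variable {k : ℕ}

/-- A matrix with holomorphic entries. -/
def HolMatrix (A : Matrix (Fin k) (Fin k) MeroGerm) : Prop := ∀ r s, IsHol (A r s)

/-- The Taylor coefficients of a matrix with holomorphic entries. -/
def taylorMatrix (A : Matrix (Fin k) (Fin k) MeroGerm) (j : ℕ) : Matrix (Fin k) (Fin k) ℂ :=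
  A.map fun φ => taylorCoeff φ j

theorem HolMatrix.mul {A B : Matrix (Fin k) (Fin k) MeroGerm} (hA : HolMatrix A)
    (hB : HolMatrix B) : HolMatrix (A * B) := fun r s => by
  rw [Matrix.mul_apply]
  exact isHol_sum _ fun l _ => (hA r l).mul (hB l s)

theorem taylorMatrix_mul {A B : Matrix (Fin k) (Fin k) MeroGerm} (hA : HolMatrix A)
    (hB : HolMatrix B) (j : ℕ) : taylorMatrix (A * B) j =
      ∑ i ∈ Finset.range (j + 1), taylorMatrix A i * taylorMatrix B (j - i) := by
  ext r s
  rw [taylorMatrix, Matrix.map_apply, Matrix.mul_apply,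
    taylorCoeff_sum _ fun l _ => (hA r l).mul (hB l s), Matrix.sum_apply]
  simp only [Matrix.mul_apply, taylorCoeff_mul (hA _ _) (hB _ _)]
  exact Finset.sum_comm

open scoped Matrix.Norms.Operator in
theorem HolMatrix.geomBdd {A : Matrix (Fin k) (Fin k) MeroGerm} (hA : HolMatrix A) :
    GeomBdd (taylorMatrix A) := by
  have h : ∀ j, taylorMatrix A j = ∑ r, ∑ s,
      LinearMap.toSpanSingleton ℂ _ (Matrix.single r s (1 : ℂ)) (taylorCoeff (A r s) j) := by
    intro j
    conv_lhs => rw [Matrix.matrix_eq_sum_single (taylorMatrix A j)]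
    simp [taylorMatrix, Matrix.smul_single]
  rw [funext h]
  exact GeomBdd.sum _ fun r _ => GeomBdd.sum _ fun s _ => (hA r s).geomBdd.map _

open scoped Matrix.Norms.Operator in
/-- Two Fuchsian systems with the same `N`-jets are gauge equivalent if no two eigenvalues of the
residue matrix differ by an integer greater than `N`. -/
theorem exists_gauge {A B : Matrix (Fin k) (Fin k) MeroGerm} (hA : HolMatrix A) (hB : HolMatrix B)
    {N : ℕ} (hAB : ∀ j ≤ N, taylorMatrix A j = taylorMatrix B j)
    (hres : ∀ j : ℕ, N < j → ∀ Z : Matrix (Fin k) (Fin k) ℂ,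
      taylorMatrix A 0 * Z - Z * taylorMatrix A 0 = (j : ℂ) • Z → Z = 0) :
    ∃ Y : Matrix (Fin k) (Fin k) MeroGerm, HolMatrix Y ∧ taylorMatrix Y 0 = 1 ∧
      Y.map eu = B * Y - Y * A := by
  obtain ⟨C, ρ, hC, hρ, hAb⟩ := hA.geomBdd
  obtain ⟨D, σ, hD, hσ, hBb⟩ := hB.geomBdd
  -- With `Y = 1 + W` the equation becomes `ϵW = BW - WA + (B - A)`, a linear Fuchsian system on the
  -- space of matrices whose inhomogeneity is O(t^(N+1)).
  let T : ℕ → Matrix (Fin k) (Fin k) ℂ →ₗ[ℂ] Matrix (Fin k) (Fin k) ℂ := fun i =>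
    LinearMap.mulLeft ℂ (taylorMatrix B i) - LinearMap.mulRight ℂ (taylorMatrix A i)
  have hT : ∀ i Z, T i Z = taylorMatrix B i * Z - Z * taylorMatrix A i := fun i Z => rfl
  have hTb : ∀ i Z, ‖T i Z‖ ≤ (C + D) * max ρ σ ^ i * ‖Z‖ := by
    intro i Z
    have h1 : ‖taylorMatrix A i‖ ≤ C * max ρ σ ^ i :=
      (hAb i).trans (by gcongr; exact le_max_left _ _)
    have h2 : ‖taylorMatrix B i‖ ≤ D * max ρ σ ^ i :=
      (hBb i).trans (by gcongr; exact le_max_right _ _)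
    calc ‖T i Z‖ ≤ ‖taylorMatrix B i * Z‖ + ‖Z * taylorMatrix A i‖ := norm_sub_le _ _
      _ ≤ ‖taylorMatrix B i‖ * ‖Z‖ + ‖Z‖ * ‖taylorMatrix A i‖ :=
          add_le_add (norm_mul_le _ _) (norm_mul_le _ _)
      _ ≤ D * max ρ σ ^ i * ‖Z‖ + ‖Z‖ * (C * max ρ σ ^ i) := by gcongr
      _ = _ := by ring
  have hg : GeomBdd fun j => taylorMatrix B j + -taylorMatrix A j := by
    refine hB.geomBdd.add ?_
    exact hA.geomBdd.map (-LinearMap.id : Matrix (Fin k) (Fin k) ℂ →ₗ[ℂ] Matrix (Fin k) (Fin k) ℂ)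
  obtain ⟨z, hz, hzN, hzrec⟩ := exists_geomBdd_solution T _ N (add_pos hC hD)
    (lt_max_of_lt_left hρ) hTb hg (fun j hj => by rw [hAB j hj, add_neg_cancel]) (by
      intro j hj Z hZ
      refine hres j hj Z ?_
      rw [hT, ← hAB 0 (Nat.zero_le N)] at hZ
      exact hZ)
  have hentry : ∀ r s, GeomBdd fun j => z j r s := fun r s =>
    hz.map (Matrix.entryLinearMap ℂ ℂ r s)
  obtain ⟨W, hW, hWz⟩ : ∃ W : Matrix (Fin k) (Fin k) MeroGerm,
      HolMatrix W ∧ ∀ j, taylorMatrix W j = z j := by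
    choose Z hZ hZc using fun r s => (hentry r s).exists_isHol
    exact ⟨Matrix.of Z, hZ, fun j => Matrix.ext fun r s => hZc r s j⟩
  have hWc : ∀ r s j, taylorCoeff (W r s) j = z j r s := fun r s j => by rw [← hWz j]; rfl
  have h1 : ∀ r s, IsHol ((1 : Matrix (Fin k) (Fin k) MeroGerm) r s) := fun r s => by
    rw [Matrix.one_apply]
    split_ifs
    exacts [isHol_one, isHol_zero]
  refine ⟨1 + W, fun r s => (h1 r s).add (hW r s), ?_, ?_⟩
  · refine Matrix.ext fun r s => ?_
    rw [taylorMatrix, Matrix.map_apply, Matrix.add_apply, taylorCoeff_add (h1 r s) (hW r s)]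
    rw [hWc, hzN 0 (Nat.zero_le N), Matrix.one_apply, Matrix.one_apply]
    split_ifs <;> simp [taylorCoeff_one, taylorCoeff_zero]
  · have heu : eu (1 : MeroGerm) = 0 := by simp [eu_apply]
    have hkey : (W).map eu =
        B * W - W * A + (B - A) := by
      refine Matrix.ext fun r s => ?_
      simp only [Matrix.map_apply, Matrix.add_apply, Matrix.sub_apply]
      have hBW := hB.mul hW r s
      have hWA := hW.mul hA r s
      refine IsHol.ext (hW r s).eu ((hBW.sub hWA).add ((hB r s).sub (hA r s))) fun j => ?_
      rw [taylorCoeff_add (hBW.sub hWA) ((hB r s).sub (hA r s)), taylorCoeff_sub hBW hWA,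
        taylorCoeff_sub (hB r s) (hA r s), taylorCoeff_eu (hW r s)]
      have e1 := congrFun (congrFun (taylorMatrix_mul hB hW j) r) s
      have e2 := congrFun (congrFun (taylorMatrix_mul hW hA j) r) s
      have e3 := congrFun (congrFun (hzrec j) r) s
      -- The Cauchy product for `B * W` carries the index on `B`, the recursion on `z`; the sum is
      -- reversed to match.
      rw [← Finset.sum_flip] at e1
      simp only [hWz] at e1 e2
      rw [Finset.sum_congr rfl fun i hi => by
        rw [Nat.sub_sub_self (Nat.lt_succ_iff.1 (Finset.mem_range.1 hi))]] at e1
      simp only [hT, Finset.sum_sub_distrib, Matrix.add_apply, Matrix.sub_apply,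
        Matrix.smul_apply, Matrix.neg_apply, smul_eq_mul] at e3
      rw [← e1, ← e2] at e3
      rw [hWc, e3]
      simp only [taylorMatrix, Matrix.map_apply]
      ring
    have hmap : (1 + W).map eu = (W).map eu := by
      refine Matrix.ext fun r s => ?_
      rw [Matrix.map_apply, Matrix.map_apply, Matrix.add_apply, map_add, Matrix.one_apply]
      split_ifs <;> simp [heu]
    rw [hmap, hkey]
    noncomm_ring

end

/-! ### Operators with holomorphic coefficients -/

theorem mulOp_mul (a b : MeroGerm) : mulOp (a * b) = mulOp a * mulOp b :=
  map_mul (Algebra.lmul ℂ MeroGerm) a b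

theorem mulOp_add (a b : MeroGerm) : mulOp (a + b) = mulOp a + mulOp b :=
  map_add (Algebra.lmul ℂ MeroGerm) a b

theorem mulOp_sub (a b : MeroGerm) : mulOp (a - b) = mulOp a - mulOp b :=
  map_sub (Algebra.lmul ℂ MeroGerm) a b

theorem mulOp_neg_mul (a : MeroGerm) (T : Module.End ℂ MeroGerm) :
    mulOp (-a) * T = -(mulOp a * T) :=
  LinearMap.ext fun φ => neg_mul a (T φ)

theorem mulOp_zero : mulOp 0 = 0 := map_zero (Algebra.lmul ℂ MeroGerm)

theorem mulOp_one : mulOp 1 = 1 := map_one (Algebra.lmul ℂ MeroGerm)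

theorem mulOp_sum {ι : Type*} (s : Finset ι) (a : ι → MeroGerm) :
    mulOp (∑ i ∈ s, a i) = ∑ i ∈ s, mulOp (a i) :=
  map_sum (Algebra.lmul ℂ MeroGerm) a s

theorem eu_mul_mulOp (a : MeroGerm) : eu * mulOp a = mulOp (eu a) + mulOp a * eu := by
  refine LinearMap.ext fun φ => ?_
  simp only [Module.End.mul_apply, LinearMap.add_apply, LinearMap.mulLeft_apply, eu_apply,
    Derivation.leibniz, smul_eq_mul]
  ring

theorem toOp_add (P Q : MeroGerm[X]) : toOp (P + Q) = toOp P + toOp Q := by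
  have h := natDegree_add_le P Q
  set n := max P.natDegree Q.natDegree
  rw [toOp_eq_sum_range (P + Q) (Nat.lt_succ_of_le h),
    toOp_eq_sum_range P (Nat.lt_succ_of_le (le_max_left _ Q.natDegree)),
    toOp_eq_sum_range Q (Nat.lt_succ_of_le (le_max_right P.natDegree _)),
    ← Finset.sum_add_distrib]
  refine Finset.sum_congr rfl fun i _ => ?_
  rw [coeff_add, mulOp_add, add_mul]

theorem toOp_zero : toOp 0 = 0 := by simp [toOp]

theorem toOp_sum {ι : Type*} (s : Finset ι) (P : ι → MeroGerm[X]) :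
    toOp (∑ i ∈ s, P i) = ∑ i ∈ s, toOp (P i) :=
  map_sum (AddMonoidHom.mk' toOp toOp_add) P s

theorem toOp_monomial (i : ℕ) (a : MeroGerm) : toOp (monomial i a) = mulOp a * eu ^ i := by
  by_cases ha : a = 0
  · simp [ha, toOp_zero]
  · rw [toOp, support_monomial i ha, Finset.sum_singleton, coeff_monomial_same]

/-- The operators of order less than `d` with holomorphic coefficients. -/
def holOps (d : ℕ) : AddSubmonoid (Module.End ℂ MeroGerm) :=
  AddSubmonoid.closure {T | ∃ a i, IsHol a ∧ i < d ∧ T = mulOp a * eu ^ i}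

theorem mulOp_mul_mem_holOps {a : MeroGerm} (ha : IsHol a) {d : ℕ} {T : Module.End ℂ MeroGerm}
    (hT : T ∈ holOps d) : mulOp a * T ∈ holOps d := by
  induction hT using AddSubmonoid.closure_induction with
  | mem T hT =>
    obtain ⟨b, i, hb, hi, rfl⟩ := hT
    rw [← mul_assoc, ← mulOp_mul]
    exact AddSubmonoid.subset_closure ⟨_, i, ha.mul hb, hi, rfl⟩
  | zero => rw [mul_zero]; exact zero_mem _
  | add S T _ _ hS hT => rw [mul_add]; exact add_mem hS hT

theorem mulOp_mem_holOps {a : MeroGerm} (ha : IsHol a) (d : ℕ) : mulOp a ∈ holOps (d + 1) :=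
  AddSubmonoid.subset_closure ⟨a, 0, ha, d.succ_pos, by rw [pow_zero, mul_one]⟩

theorem holOps_mono {d e : ℕ} (h : d ≤ e) : holOps d ≤ holOps e :=
  AddSubmonoid.closure_mono fun _ ⟨a, i, ha, hi, hT⟩ => ⟨a, i, ha, hi.trans_le h, hT⟩

theorem eu_mul_mem_holOps {d : ℕ} {T : Module.End ℂ MeroGerm} (hT : T ∈ holOps d) :
    eu * T ∈ holOps (d + 1) := by
  induction hT using AddSubmonoid.closure_induction with
  | mem T hT =>
    obtain ⟨b, i, hb, hi, rfl⟩ := hT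
    rw [← mul_assoc, eu_mul_mulOp, add_mul, mul_assoc, ← pow_succ']
    exact add_mem (AddSubmonoid.subset_closure ⟨_, i, hb.eu, by omega, rfl⟩)
      (AddSubmonoid.subset_closure ⟨_, i + 1, hb, by omega, rfl⟩)
  | zero => rw [mul_zero]; exact zero_mem _
  | add S T _ _ hS hT => rw [mul_add]; exact add_mem hS hT

theorem exists_toOp_eq_of_mem_holOps {d : ℕ} {T : Module.End ℂ MeroGerm} (hT : T ∈ holOps d) :
    ∃ P : MeroGerm[X], (∀ i, IsHol (P.coeff i)) ∧ (∀ i, d ≤ i → P.coeff i = 0) ∧ toOp P = T := by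
  induction hT using AddSubmonoid.closure_induction with
  | mem T hT =>
    obtain ⟨b, i, hb, hi, rfl⟩ := hT
    refine ⟨monomial i b, fun k => ?_, fun k hk => ?_, toOp_monomial i b⟩
    · rw [coeff_monomial]
      split_ifs
      exacts [hb, isHol_zero]
    · rw [coeff_monomial, if_neg (by omega)]
  | zero => exact ⟨0, fun _ => isHol_zero, fun _ _ => rfl, toOp_zero⟩
  | add S T _ _ hS hT =>
    obtain ⟨P, hP, hPd, rfl⟩ := hS
    obtain ⟨Q, hQ, hQd, rfl⟩ := hT
    refine ⟨P + Q, fun i => ?_, fun i hi => ?_, toOp_add P Q⟩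
    · rw [coeff_add]
      exact (hP i).add (hQ i)
    · rw [coeff_add, hPd i hi, hQd i hi, add_zero]

/-- Division of `ϵ ^ (s + 1)` by an operator `L` of order `m + 1` whose leading coefficient has the
inverse `u`. -/
theorem eu_pow_succ_eq {m : ℕ} {L : MeroGerm[X]} (hL : L.natDegree ≤ m + 1) {u : MeroGerm}
    (hu : L.coeff (m + 1) * u = 1) (s : Fin (m + 1)) :
    eu ^ ((s : ℕ) + 1) =
      ∑ i : Fin (m + 1), mulOp (companion m (fun i => u * L.coeff i) s i) * eu ^ (i : ℕ) +
        mulOp (if s = Fin.last m then u else 0) * toOp L := by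
  by_cases hs : s = Fin.last m
  · subst hs
    simp only [companion_last, if_true, mulOp_neg_mul, mulOp_mul, Finset.sum_neg_distrib]
    rw [toOp_eq_sum_range L (Nat.lt_succ_of_le hL), Finset.sum_range_succ, mul_add,
      ← mul_assoc (mulOp u), ← mulOp_mul, mul_comm u (L.coeff (m + 1)), hu, mulOp_one, one_mul,
      Finset.mul_sum, Fin.sum_univ_eq_sum_range (fun i => mulOp u * mulOp (L.coeff i) * eu ^ i)]
    simp only [mul_assoc, Fin.val_last]
    abel
  · obtain ⟨s, hs'⟩ := s
    have hsm : s < m := by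
      have : s ≠ m := fun h => hs (Fin.ext h)
      omega
    simp only [companion_of_lt _ hsm, if_neg hs, mulOp_zero, zero_mul, add_zero]
    rw [Finset.sum_eq_single (⟨s + 1, by omega⟩ : Fin (m + 1))]
    · rw [if_pos rfl, mulOp_one, one_mul]
    · intro i _ hi
      rw [if_neg hi.symm, mulOp_zero, zero_mul]
    · simp

/-- A gauge transformation between the companion systems of `L` and `M` gives an operator `H` such
that `M H` is a left multiple of `L`. -/
theorem exists_mul_eq_mul_of_gauge {m : ℕ} {L M : MeroGerm[X]} (hLd : L.natDegree ≤ m + 1)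
    (hMd : M.natDegree ≤ m + 1) (hM : ∀ i, IsHol (M.coeff i)) {u v : MeroGerm} (hu : IsHol u)
    (huL : L.coeff (m + 1) * u = 1) (hvM : M.coeff (m + 1) * v = 1)
    {Y : Matrix (Fin (m + 1)) (Fin (m + 1)) MeroGerm} (hY : HolMatrix Y)
    (hgauge : Y.map eu =
      companion m (fun i => v * M.coeff i) * Y - Y * companion m (fun i => u * L.coeff i)) :
    ∃ K ∈ holOps (m + 1),
      toOp M * ∑ i : Fin (m + 1), mulOp (Y 0 i) * eu ^ (i : ℕ) = K * toOp L := by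
  set A := companion m (fun i => u * L.coeff i) with hA
  set B := companion m (fun i => v * M.coeff i) with hB
  -- Row `r` of `Y` applied to the column `(1, ϵ, …, ϵ ^ m)`. That column satisfies the companion
  -- system of `L` up to a left multiple of `L` in its last entry, so by the gauge equation the `H
  -- r` satisfy the system of `M` modulo left multiples of `L`.
  let H : Fin (m + 1) → Module.End ℂ MeroGerm := fun r => ∑ i, mulOp (Y r i) * eu ^ (i : ℕ)
  have hstep : ∀ r, eu * H r =
      ∑ s, mulOp (B r s) * H s + mulOp (Y r (Fin.last m) * u) * toOp L := by
    intro r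
    have h1 : eu * H r = ∑ i, mulOp (eu (Y r i)) * eu ^ (i : ℕ) +
        ∑ s, mulOp (Y r s) * eu ^ ((s : ℕ) + 1) := by
      rw [Finset.mul_sum, ← Finset.sum_add_distrib]
      refine Finset.sum_congr rfl fun i _ => ?_
      rw [← mul_assoc, eu_mul_mulOp, add_mul, mul_assoc (mulOp (Y r i)), ← pow_succ']
    have h2 : ∑ s, mulOp (Y r s) * eu ^ ((s : ℕ) + 1) =
        ∑ i, mulOp ((Y * A) r i) * eu ^ (i : ℕ) + mulOp (Y r (Fin.last m) * u) * toOp L := by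
      simp only [eu_pow_succ_eq hLd huL, mul_add, Finset.sum_add_distrib, Matrix.mul_apply,
        mulOp_sum, Finset.mul_sum, Finset.sum_mul, mulOp_mul, mul_assoc]
      congr 1
      · exact Finset.sum_comm
      · rw [Finset.sum_eq_single (Fin.last m)]
        · rw [if_pos rfl]
        · intro s _ hs
          rw [if_neg hs, mulOp_zero, zero_mul, mul_zero]
        · simp
    have h3 : ∑ s, mulOp (B r s) * H s = ∑ i, mulOp ((B * Y) r i) * eu ^ (i : ℕ) := by
      simp only [H, Matrix.mul_apply, mulOp_sum, Finset.mul_sum, Finset.sum_mul, mulOp_mul,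
        mul_assoc]
      exact Finset.sum_comm
    have h4 : ∀ i, eu (Y r i) = (B * Y) r i - (Y * A) r i := fun i =>
      congrFun (congrFun hgauge r) i
    rw [h1, h2, h3]
    simp only [h4, mulOp_sub, sub_mul, Finset.sum_sub_distrib]
    abel
  -- All rows of `B` but the last are shifts, so modulo left multiples of `L` each `H r` is `ϵ ^ r *
  -- H 0`. The order of the cofactor is tracked since `K` must end up of lower order than `M`.
  have hchain : ∀ (r : ℕ) (hr : r < m + 1),
      ∃ K ∈ holOps r, eu ^ r * H 0 = H ⟨r, hr⟩ + K * toOp L := by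
    intro r hr
    induction r with
    | zero => exact ⟨0, zero_mem _, by rw [pow_zero, one_mul, zero_mul, add_zero]; rfl⟩
    | succ r ih =>
      obtain ⟨K, hK, h⟩ := ih (by omega)
      refine ⟨mulOp (Y ⟨r, by omega⟩ (Fin.last m) * u) + eu * K,
        add_mem (mulOp_mem_holOps ((hY _ _).mul hu) r) (eu_mul_mem_holOps hK), ?_⟩
      rw [pow_succ', mul_assoc, h, mul_add, hstep, add_mul, mul_assoc eu, ← add_assoc]
      congr 2
      simp only [hB, companion_of_lt _ (show r < m by omega)]
      rw [Finset.sum_eq_single (⟨r + 1, hr⟩ : Fin (m + 1))]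
      · rw [if_pos rfl, mulOp_one, one_mul]
      · intro i _ hi
        rw [if_neg hi.symm, mulOp_zero, zero_mul]
      · simp
  choose K hK hKH using fun r : Fin (m + 1) => hchain r r.2
  -- The last row of `B` holds the coefficients of `M` divided by the leading one; multiplying by
  -- that coefficient clears `v`.
  have htop : mulOp (M.coeff (m + 1)) * eu ^ (m + 1) * H 0 =
      -∑ s : Fin (m + 1), mulOp (M.coeff s) * H s +
        mulOp (M.coeff (m + 1)) * (mulOp (Y (Fin.last m) (Fin.last m) * u) +
          eu * K (Fin.last m)) * toOp L := by
    have h1 : ∀ s : Fin (m + 1), mulOp (M.coeff (m + 1)) * (mulOp (B (Fin.last m) s) * H s) =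
        -(mulOp (M.coeff s) * H s) := by
      intro s
      rw [hB, companion_last, ← mul_assoc, ← mulOp_mul, mul_neg, ← mul_assoc, hvM, one_mul,
        mulOp_neg_mul]
    have h2 : eu ^ m * H 0 = H (Fin.last m) + K (Fin.last m) * toOp L := hKH (Fin.last m)
    rw [pow_succ', mul_assoc, mul_assoc, h2, mul_add, hstep, mul_add, mul_add, Finset.mul_sum]
    simp only [h1, Finset.sum_neg_distrib, mul_add, add_mul, mul_assoc]
    abel
  refine ⟨∑ s : Fin (m + 1), mulOp (M.coeff s) * K s + mulOp (M.coeff (m + 1)) *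
    (mulOp (Y (Fin.last m) (Fin.last m) * u) + eu * K (Fin.last m)), ?_, ?_⟩
  · refine add_mem (sum_mem fun s _ => mulOp_mul_mem_holOps (hM s) (holOps_mono s.2.le (hK s)))
      (mulOp_mul_mem_holOps (hM _) (add_mem (mulOp_mem_holOps ((hY _ _).mul hu) m) ?_))
    exact eu_mul_mem_holOps (hK (Fin.last m))
  · change toOp M * H 0 = _
    rw [toOp_eq_sum_range M (Nat.lt_succ_of_le hMd), Finset.sum_range_succ, add_mul, htop,
      ← Fin.sum_univ_eq_sum_range (fun i => mulOp (M.coeff i) * eu ^ i), Finset.sum_mul]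
    simp only [mul_assoc, hKH, mul_add, add_mul, Finset.sum_add_distrib, Finset.sum_mul]
    abel

/-! ### Taylor polynomials and truncation -/

theorem coeff_taylorPoly (L : MeroGerm[X]) (j i : ℕ) :
    (taylorPoly L j).coeff i = taylorCoeff (L.coeff i) j := by
  rw [taylorPoly, finsetSum_coeff]
  simp only [coeff_monomial]
  rw [Finset.sum_ite_eq' L.support i]
  split_ifs with h
  · rfl
  · rw [notMem_support_iff.1 h, taylorCoeff_zero]

theorem natDegree_taylorPoly_le (L : MeroGerm[X]) (j : ℕ) :
    (taylorPoly L j).natDegree ≤ L.natDegree :=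
  natDegree_le_iff_coeff_eq_zero.2 fun i hi => by
    rw [coeff_taylorPoly, coeff_eq_zero_of_natDegree_lt hi, taylorCoeff_zero]

theorem isHol_polyGerm (b : ℂ[X]) : IsHol (polyGerm b) := by
  induction b using Polynomial.induction_on with
  | C a => rw [polyGerm, aeval_C]; exact isHol_algebraMap a
  | add p q hp hq => rw [polyGerm, map_add]; exact hp.add hq
  | monomial n a h =>
    rw [polyGerm, pow_succ, ← mul_assoc, map_mul, aeval_X]
    exact h.mul isHol_tGerm

theorem taylorCoeff_polyGerm (b : ℂ[X]) (j : ℕ) : taylorCoeff (polyGerm b) j = b.coeff j := by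
  induction b using Polynomial.induction_on generalizing j with
  | C a => rw [polyGerm, aeval_C, taylorCoeff_algebraMap, coeff_C]
  | add p q hp hq =>
    rw [polyGerm, map_add, coeff_add, ← hp, ← hq]
    exact taylorCoeff_add (isHol_polyGerm p) (isHol_polyGerm q) j
  | monomial n a h =>
    rw [polyGerm, pow_succ, ← mul_assoc, map_mul, aeval_X, mul_comm]
    cases j with
    | zero => rw [coeff_mul_X_zero]; exact taylorCoeff_tGerm_mul_zero (isHol_polyGerm _)
    | succ j =>
      rw [coeff_mul_X, ← h]
      exact taylorCoeff_tGerm_mul_succ (isHol_polyGerm _) j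

/-- The truncation at order `N` of the Taylor series of a holomorphic germ. -/
def taylorTrunc (φ : MeroGerm) (N : ℕ) : ℂ[X] :=
  ∑ j ∈ Finset.range (N + 1), monomial j (taylorCoeff φ j)

theorem coeff_taylorTrunc (φ : MeroGerm) (N j : ℕ) :
    (taylorTrunc φ N).coeff j = if j ≤ N then taylorCoeff φ j else 0 := by
  rw [taylorTrunc, finsetSum_coeff]
  simp only [coeff_monomial]
  rw [Finset.sum_ite_eq' (Finset.range (N + 1)) j]
  simp

theorem natDegree_taylorTrunc_le (φ : MeroGerm) (N : ℕ) : (taylorTrunc φ N).natDegree ≤ N :=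
  natDegree_le_iff_coeff_eq_zero.2 fun j hj => by
    rw [coeff_taylorTrunc, if_neg (not_le.2 hj)]

theorem coeff_truncate (L : MeroGerm[X]) (N i : ℕ) :
    (truncate L N).coeff i = polyGerm (taylorTrunc (L.coeff i) N) := by
  rw [truncate, finsetSum_coeff, polyGerm, taylorTrunc, map_sum]
  refine Finset.sum_congr rfl fun j _ => ?_
  rw [coeff_C_mul, coeff_map, coeff_taylorPoly, aeval_monomial, mul_comm]

theorem isHol_coeff_truncate (L : MeroGerm[X]) (N i : ℕ) : IsHol ((truncate L N).coeff i) := by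
  rw [coeff_truncate]
  exact isHol_polyGerm _

theorem taylorCoeff_coeff_truncate (L : MeroGerm[X]) {N j : ℕ} (hj : j ≤ N) (i : ℕ) :
    taylorCoeff ((truncate L N).coeff i) j = taylorCoeff (L.coeff i) j := by
  rw [coeff_truncate, taylorCoeff_polyGerm, coeff_taylorTrunc, if_pos hj]

/-- The leading coefficient keeps its nonzero constant term under truncation, even for `N = 0`. -/
theorem natDegree_truncate {L : MeroGerm[X]} (hL : IsFuchsian L) (N : ℕ) :
    (truncate L N).natDegree = L.natDegree := by
  refine natDegree_eq_of_le_of_coeff_ne_zero ?_ fun h => hL.2 ?_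
  · refine natDegree_le_iff_coeff_eq_zero.2 fun i hi => ?_
    rw [coeff_truncate, coeff_eq_zero_of_natDegree_lt hi]
    simp [taylorTrunc, taylorCoeff_zero, polyGerm]
  · rw [leadingCoeff, ← taylorCoeff_coeff_truncate L (Nat.zero_le N), h, taylorCoeff_zero]

theorem isFuchsian_truncate {L : MeroGerm[X]} (hL : IsFuchsian L) (N : ℕ) :
    IsFuchsian (truncate L N) := by
  refine ⟨isHol_coeff_truncate L N, ?_⟩
  rw [leadingCoeff, natDegree_truncate hL, taylorCoeff_coeff_truncate L (Nat.zero_le N)]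
  exact hL.2

theorem toOp_C_mul_map (a : MeroGerm) (p : ℂ[X]) :
    toOp (C a * p.map (algebraMap ℂ MeroGerm)) = mulOp a * aeval eu p := by
  induction p using Polynomial.induction_on' with
  | add p q hp hq => rw [Polynomial.map_add, mul_add, toOp_add, hp, hq, map_add, mul_add]
  | monomial n c =>
    rw [map_monomial, C_mul_monomial, toOp_monomial, aeval_monomial, mulOp_mul, mul_assoc]
    congr 2

theorem toOp_truncate (L : MeroGerm[X]) (N : ℕ) :
    toOp (truncate L N) =
      ∑ j ∈ Finset.range (N + 1), mulOp (tGerm ^ j) * aeval eu (taylorPoly L j) := by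
  rw [truncate, toOp_sum]
  exact Finset.sum_congr rfl fun j _ => toOp_C_mul_map _ _

/-- The Taylor coefficients of a quotient are determined by those of the numerator and the
denominator of lower or equal order. -/
theorem taylorCoeff_mul_eq_of_jets_eq {φ ψ φ' ψ' u u' : MeroGerm} (hφ : IsHol φ) (hψ : IsHol ψ)
    (hφ' : IsHol φ') (hψ' : IsHol ψ') (hu : IsHol u) (hu' : IsHol u') (h : ψ * u = 1)
    (h' : ψ' * u' = 1) {N : ℕ} (hjφ : ∀ j ≤ N, taylorCoeff φ j = taylorCoeff φ' j)
    (hjψ : ∀ j ≤ N, taylorCoeff ψ j = taylorCoeff ψ' j) :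
    ∀ j ≤ N, taylorCoeff (u * φ) j = taylorCoeff (u' * φ') j := by
  have key : ∀ {a b : MeroGerm}, IsHol a → IsHol b → (∀ j ≤ N, taylorCoeff b j = 0) →
      ∀ j ≤ N, taylorCoeff (a * b) j = 0 := by
    intro a b ha hb hbN j hj
    rw [taylorCoeff_mul ha hb]
    refine Finset.sum_eq_zero fun i _ => ?_
    rw [hbN (j - i) (by omega), mul_zero]
  -- This uses `u - u' = -u * u' * (ψ - ψ')`, so the difference of the quotients is a holomorphic
  -- combination of two germs with vanishing `N`-jet.
  have e : u * φ - u' * φ' = u * (φ - φ') + -(φ' * u * u') * (ψ - ψ') := by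
    linear_combination (φ' * u') * h - (φ' * u) * h'
  have hd1 := hφ.sub hφ'
  have hd2 := hψ.sub hψ'
  have hc := ((hφ'.mul hu).mul hu').neg
  intro j hj
  rw [← sub_eq_zero, ← taylorCoeff_sub (hu.mul hφ) (hu'.mul hφ'), e,
    taylorCoeff_add (hu.mul hd1) (hc.mul hd2), key hu hd1 (fun i hi => ?_) j hj,
    key hc hd2 (fun i hi => ?_) j hj, add_zero]
  · rw [taylorCoeff_sub hψ hψ', hjψ i hi, sub_self]
  · rw [taylorCoeff_sub hφ hφ', hjφ i hi, sub_self]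

theorem holMatrix_companion {m : ℕ} {c : ℕ → MeroGerm} (hc : ∀ i, IsHol (c i)) :
    HolMatrix (companion m c) := fun s i => by
  rw [companion_apply]
  refine IsHol.sub ?_ ?_
  · split_ifs
    exacts [isHol_one, isHol_zero]
  · split_ifs
    exacts [hc i, isHol_zero]

theorem taylorMatrix_companion {m : ℕ} {c : ℕ → MeroGerm} (hc : ∀ i, IsHol (c i)) (j : ℕ) :
    taylorMatrix (companion m c) j = Matrix.of fun s i : Fin (m + 1) =>
      (if (s : ℕ) + 1 = i then (if j = 0 then 1 else 0) else 0) -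
        if s = Fin.last m then taylorCoeff (c i) j else 0 := by
  refine Matrix.ext fun s i => ?_
  rw [taylorMatrix, Matrix.map_apply, companion_apply, Matrix.of_apply, taylorCoeff_sub]
  · congr 1
    · split_ifs <;> simp_all [taylorCoeff_one, taylorCoeff_zero]
    · split_ifs
      exacts [rfl, taylorCoeff_zero j]
  · split_ifs
    exacts [isHol_one, isHol_zero]
  · split_ifs
    exacts [hc i, isHol_zero]

/-! ### Fuchsian equivalence with the truncation -/

/-- Adding an operator of lower order to a Fuchsian operator. -/
theorem IsFuchsian.add_of_lt {P L : MeroGerm[X]} (hL : IsFuchsian L)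
    (hP : ∀ i, IsHol (P.coeff i)) (hPd : ∀ i, L.natDegree ≤ i → P.coeff i = 0) :
    IsFuchsian (P + L) := by
  have hL0 : L.coeff L.natDegree ≠ 0 := fun h => hL.2 (by
    rw [leadingCoeff, h, taylorCoeff_zero])
  have hc : (P + L).coeff L.natDegree = L.leadingCoeff := by
    rw [coeff_add, hPd _ le_rfl, zero_add, leadingCoeff]
  have hd : (P + L).natDegree = L.natDegree := by
    refine natDegree_eq_of_le_of_coeff_ne_zero ?_ (hc ▸ hL0)
    refine natDegree_le_iff_coeff_eq_zero.2 fun i hi => ?_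
    rw [coeff_add, hPd i hi.le, coeff_eq_zero_of_natDegree_lt hi, add_zero]
  refine ⟨fun i => ?_, ?_⟩
  · rw [coeff_add]
    exact (hP i).add (hL.1 i)
  · rw [leadingCoeff, hd, hc]
    exact hL.2

theorem eulerPart_ne_zero {L : MeroGerm[X]} (hL : IsFuchsian L) : eulerPart L ≠ 0 := fun h =>
  hL.2 (by rw [leadingCoeff, ← coeff_taylorPoly L 0, ← eulerPart, h, coeff_zero])

theorem eulerPart_add {P L : MeroGerm[X]} (hP : ∀ i, IsHol (P.coeff i))
    (hL : ∀ i, IsHol (L.coeff i)) : eulerPart (P + L) = eulerPart P + eulerPart L := by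
  ext i
  simp only [eulerPart, coeff_add, coeff_taylorPoly, taylorCoeff_add (hP i) (hL i)]

/-- Order 0 has no companion matrix of size `m + 1`. Here `H = L` and `K = M` suffice, because the
Euler part is a nonzero constant and hence coprime to itself. -/
theorem fEquiv_truncate_of_natDegree_eq_zero {L : MeroGerm[X]} (hL : IsFuchsian L)
    (hn : L.natDegree = 0) (N : ℕ) : FEquiv L (truncate L N) := by
  refine ⟨hL, isFuchsian_truncate hL N, (natDegree_truncate hL N).symm, L, truncate L N, hL,
    isFuchsian_truncate hL N, rfl, ?_⟩
  have h := natDegree_taylorPoly_le L 0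
  rw [hn, Nat.le_zero] at h
  have hu : IsUnit (eulerPart L) := by
    rw [isUnit_iff_degree_eq_zero, degree_eq_natDegree (eulerPart_ne_zero hL)]
    exact_mod_cast h
  exact isCoprime_self.2 hu

theorem fEquiv_truncate {L : MeroGerm[X]} (hL : IsFuchsian L) {N : ℕ}
    (hN : maxNatDiff (eulerPart L) ≤ N) : FEquiv L (truncate L N) := by
  rcases hn : L.natDegree with _ | m
  · exact fEquiv_truncate_of_natDegree_eq_zero hL hn N
  set M := truncate L N with hMdef
  have hM : IsFuchsian M := isFuchsian_truncate hL N
  have hMn : M.natDegree = m + 1 := (natDegree_truncate hL N).trans hn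
  have hjet : ∀ i, ∀ j ≤ N, taylorCoeff (L.coeff i) j = taylorCoeff (M.coeff i) j :=
    fun i j hj => (taylorCoeff_coeff_truncate L hj i).symm
  have hl : taylorCoeff (L.coeff (m + 1)) 0 ≠ 0 := by
    rw [← hn]
    exact hL.2
  obtain ⟨u, hu, huL⟩ := (hL.1 (m + 1)).exists_mul_eq_one hl
  obtain ⟨v, hv, hvM⟩ := (hM.1 (m + 1)).exists_mul_eq_one (hjet _ 0 (Nat.zero_le N) ▸ hl)
  have hcA : ∀ i, IsHol (u * L.coeff i) := fun i => hu.mul (hL.1 i)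
  have hcB : ∀ i, IsHol (v * M.coeff i) := fun i => hv.mul (hM.1 i)
  have hAB : ∀ j ≤ N, taylorMatrix (companion m fun i => u * L.coeff i) j =
      taylorMatrix (companion m fun i => v * M.coeff i) j := by
    intro j hj
    rw [taylorMatrix_companion hcA, taylorMatrix_companion hcB]
    simp only [taylorCoeff_mul_eq_of_jets_eq (hL.1 _) (hL.1 _) (hM.1 _) (hM.1 _) hu hv huL hvM
      (hjet _) (hjet _) j hj]
  have hA0 : taylorMatrix (companion m fun i => u * L.coeff i) 0 =
      companion m fun i => taylorCoeff (u * L.coeff i) 0 := by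
    rw [taylorMatrix_companion hcA]
    rfl
  -- The residue matrix is the companion matrix of the Euler part made monic.
  have hann : aeval (taylorMatrix (companion m fun i => u * L.coeff i) 0) (eulerPart L) = 0 := by
    rw [hA0]
    refine aeval_companion (hn ▸ natDegree_taylorPoly_le L 0) fun i => ?_
    rw [eulerPart, coeff_taylorPoly, coeff_taylorPoly,
      ← taylorCoeff_mul_zero (hL.1 _) (hcA i), ← mul_assoc, huL, one_mul]
  obtain ⟨Y, hY, hY0, hgauge⟩ := exists_gauge (holMatrix_companion hcA) (holMatrix_companion hcB)
    hAB fun j hj Z hZ => eq_zero_of_commutator_eq_smul hann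
      (isCoprime_comp_of_maxNatDiff_lt (eulerPart_ne_zero hL) (hN.trans_lt hj)) hZ
  obtain ⟨K₀, hK₀, hMK⟩ :=
    exists_mul_eq_mul_of_gauge hn.le hMn.le hM.1 hu huL hvM hY hgauge
  obtain ⟨K, hK, hKd, rfl⟩ := exists_toOp_eq_of_mem_holOps hK₀
  let H : MeroGerm[X] := ∑ i : Fin (m + 1), monomial (i : ℕ) (Y 0 i)
  have hHop : toOp H = ∑ i : Fin (m + 1), mulOp (Y 0 i) * eu ^ (i : ℕ) := by
    rw [toOp_sum]
    exact Finset.sum_congr rfl fun i _ => toOp_monomial _ _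
  have hHc : ∀ i, H.coeff i = if h : i < m + 1 then Y 0 ⟨i, h⟩ else 0 := by
    intro i
    simp only [H, finsetSum_coeff, coeff_monomial]
    split_ifs with h
    · rw [Finset.sum_eq_single (⟨i, h⟩ : Fin (m + 1))]
      · exact if_pos rfl
      · exact fun k _ hk => if_neg fun hki => hk (Fin.ext hki)
      · simp
    · exact Finset.sum_eq_zero fun k _ => if_neg (by omega)
  have hH : ∀ i, IsHol (H.coeff i) := fun i => by
    rw [hHc]
    split_ifs
    exacts [hY _ _, isHol_zero]
  have hH0 : eulerPart H = 1 := by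
    ext i
    rw [eulerPart, coeff_taylorPoly, hHc, coeff_one]
    split_ifs with h1 h2 h2
    · subst h2
      exact congrFun (congrFun hY0 0) 0
    · refine (congrFun (congrFun hY0 0) ⟨i, h1⟩).trans (Matrix.one_apply_ne ?_)
      exact fun h => h2 (congrArg Fin.val h).symm
    · omega
    · exact taylorCoeff_zero 0
  -- Adding `L` to `H` and `M` to `K` adds `M * L` to both sides of `M * H = K * L` and makes both
  -- factors Fuchsian.
  refine ⟨hL, hM, hn.trans hMn.symm, H + L, K + M,
    hL.add_of_lt hH fun i hi => ?_, hM.add_of_lt hK fun i hi => hKd i (hMn ▸ hi), ?_, ?_⟩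
  · rw [hHc, dif_neg (by omega)]
  · rw [toOp_add, toOp_add, mul_add, add_mul, hHop, hMK]
  · rw [eulerPart_add hH hL.1, hH0]
    exact ⟨1, -1, by ring⟩

end Fuchs

end

theorem proposition3 (L : Polynomial Fuchs.MeroGerm) (hL : Fuchs.IsFuchsian L) (N : ℕ)
    (hN : N = Fuchs.maxNatDiff (Fuchs.eulerPart L)) :
    Fuchs.FEquiv L (Fuchs.truncate L N) ∧
    Fuchs.toOp (Fuchs.truncate L N) =
      ∑ j ∈ Finset.range (N + 1),
        Fuchs.mulOp (Fuchs.tGerm ^ j) * Polynomial.aeval Fuchs.eu (Fuchs.taylorPoly L j) ∧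
    ∀ i : ℕ, ∃ b : Polynomial ℂ, b.natDegree ≤ N ∧
      (∀ j ≤ N, b.coeff j = Fuchs.taylorCoeff (L.coeff i) j) ∧
      (Fuchs.truncate L N).coeff i = Fuchs.polyGerm b :=
  ⟨Fuchs.fEquiv_truncate hL hN.ge, Fuchs.toOp_truncate L N, fun i =>
    ⟨Fuchs.taylorTrunc (L.coeff i) N, Fuchs.natDegree_taylorTrunc_le _ N,
      fun j hj => by rw [Fuchs.coeff_taylorTrunc, if_pos hj], Fuchs.coeff_truncate L N i⟩⟩
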